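/- Let $u=(u_n)_{n\ge 0}$ be a Sturmian sequence, i.e. a sequence with values in $\{0,1\}$ that has, for every $n\ge 1$, exactly $n+1$ distinct blocks of $n$ consecutive terms. A binary sequence $u$ has slope $\beta\in\mathbb R$ if for some $\rho\in\mathbb R$ either $u_n=\lfloor (n+1)\beta+\rho\rfloor-\lfloor n\beta+\rho\rfloor$ for all $n\ge 0$, or $u_n=\lceil (n+1)\beta+\rho\rceil-\lceil n\beta+\rho\rceil$ for all $n\ge 0$. For $N\ge 1$ let $\Gamma_N\subset\mathbb R^2$ be the polygonal curve formed by the segments from $(n,u_n)$ to $(n+1,u_{n+1})$, $0\le n<N$, let $\ell(\Gamma_N)$ be its length and $\delta(\Gamma_N)$ the perimeter of its convex hull (twice the length if the hull is a segment). Put $\mathcal I_N(u)=2\,\ell(\Gamma_N)/\delta(\Gamma_N)$. The inconstancy of $u$ is $\mathcal I(u)=\limsup_{N\to\infty}\mathcal I_N(u)$. Then $u$ has exactly one slope, and: 1. If the block $11$ does not occur in $u$ and $\alpha$ is the slope of $u$, then $\alpha\in(0,1/2)$, the limit $\lim_{N\to\infty}\mathcal I_N(u)$ exists, and $$\mathcal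 I(u)=\lim_{N\to\infty}\mathcal I_N(u)=1+2(\sqrt2-1)\,\alpha .$$ 2. If the block $00$ does not occur in $u$ and $1-\alpha$ is the slope of $u$, then again $\alpha\in(0,1/2)$, the limit exists, and $\mathcal I(u)=\lim_{N\to\infty}\mathcal I_N(u)=1+2(\sqrt2-1)\,\alpha$. -/

import Mathlib

open MeasureTheory Filter Topology

namespace Inconstancy

noncomputable section

/-! ### Perimeter of a convex set and inconstancy -/

/-- The Euclidean plane. -/
abbrev Plane : Type := EuclideanSpace ℝ (Fin 2)

/-- The perimeter of a compact convex plane set `K`: the length (one-dimensional Hausdorff measure)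
of its boundary if `K` has interior points. If `K` has no interior point it is a segment, and the
closed curve forming its edge runs through it twice, so the perimeter is twice its length. -/
def perimeter (K : Set Plane) : ℝ :=
  open Classical in
  if (interior K).Nonempty then (μH[1] (frontier K)).toReal else 2 * (μH[1] K).toReal

/-- The point `(n, u n)` of the graph of a real sequence. -/
def graphPoint (u : ℕ → ℝ) (n : ℕ) : Plane := !₂[(n : ℝ), u n]

/-- The curve `Γ_N`: the union of the segments joining `(n, u n)` to `(n + 1, u (n + 1))` for
`0 ≤ n < N`. -/
def polyline (u : ℕ → ℝ) (N : ℕ) : Set Plane :=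
  ⋃ n ∈ Finset.range N, segment ℝ (graphPoint u n) (graphPoint u (n + 1))

/-- The length of the polygonal curve `Γ_N`. -/
def polylineLength (u : ℕ → ℝ) (N : ℕ) : ℝ :=
  ∑ n ∈ Finset.range N, dist (graphPoint u n) (graphPoint u (n + 1))

/-- The inconstancy `2 ℓ(Γ_N) / δ(Γ_N)` of the finite sequence `u 0, …, u N`, where `δ(Γ_N)` is the
perimeter of the convex hull of `Γ_N`. -/
def finiteInconstancy (u : ℕ → ℝ) (N : ℕ) : ℝ :=
  2 * polylineLength u N / perimeter (convexHull ℝ (polyline u N))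

/-- The inconstancy of an infinite real sequence: the upper limit, in `[-∞, ∞]`, of the
inconstancies of its finite initial parts. -/
def inconstancy (u : ℕ → ℝ) : EReal :=
  limsup (fun N : ℕ => (finiteInconstancy u N : EReal)) atTop

/-! ### Sturmian sequences -/

/-- The set of blocks (factors) of length `n` occurring in the sequence `u`. -/
def blocks {A : Type*} (u : ℕ → A) (n : ℕ) : Set (Fin n → A) :=
  Set.range fun k : ℕ => fun i : Fin n => u (k + i)

/-- A binary sequence is Sturmian if it has exactly `n + 1` blocks of length `n`, for each
`n ≥ 1`. -/
def IsSturmian (u : ℕ → Fin 2) : Prop :=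
  ∀ n : ℕ, 1 ≤ n → (blocks u n).ncard = n + 1

/-- The binary sequence `u` has slope `α`: for some real intercept `ρ`, it is the lower or the upper
mechanical sequence `⌊(n + 1) α + ρ⌋ - ⌊n α + ρ⌋`, resp. `⌈(n + 1) α + ρ⌉ - ⌈n α + ρ⌉`. -/
def HasSlope (u : ℕ → Fin 2) (α : ℝ) : Prop :=
  ∃ ρ : ℝ,
    (∀ n : ℕ, ((u n : ℕ) : ℤ) = ⌊((n : ℝ) + 1) * α + ρ⌋ - ⌊(n : ℝ) * α + ρ⌋) ∨
    (∀ n : ℕ, ((u n : ℕ) : ℤ) = ⌈((n : ℝ) + 1) * α + ρ⌉ - ⌈(n : ℝ) * α + ρ⌉)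

/-- A binary sequence seen as a sequence of real numbers. -/
def toReal (u : ℕ → Fin 2) (n : ℕ) : ℝ := ((u n : ℕ) : ℝ)

end

end Inconstancy

namespace Inconstancy

/-! ### Blocks of Sturmian sequences -/

/-! Each segment of `Γ_N` has length `1` or `√2`, according to whether `u` stays or changes, so
`ℓ(Γ_N) = N + (√2 - 1) C_N` with `C_N` the number of changes. The convex hull lies in `[0, N] × [0,
1]` and reaches both vertical sides, so for large `N` its perimeter is between `2N` and `2N + 2`.
Hence `2ℓ/δ` tends to `1 + (√2 - 1) γ`, where `γ = lim C_N / N`. Without `11`, a change at `n` is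
counted by `u n + u (n + 1)`, whence `γ = 2α`; without `00` it is counted by `2 - (u n + u (n +
1))`, whence `γ = 2 - 2(1 - α) = 2α`. Since `0 ≤ C_N ≤ N`, `α` lies in `[0, 1/2]`, and irrationality
excludes the endpoints.

The slope comes from the Morse–Hedlund argument. Having `n + 1` blocks of each length gives exactly
one special block of each length, recurring with bounded gaps; this forces balance
(`IsSturmian.isBalanced`). Balance gives a density `α` with discrepancy at most `1`; a rational `α`
would make `u` eventually periodic. The supremum of the discrepancy then serves as intercept. The
slope is unique because it is the frequency of ones. -/

/-- The block of length `n` of `u` that begins at position `i` can be continued in two ways. -/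
def IsSpecialAt (u : ℕ → Fin 2) (n i : ℕ) : Prop :=
  ∃ j, (∀ s < n, u (i + s) = u (j + s)) ∧ u (i + n) ≠ u (j + n)

/-- The number of ones among the first `n` terms of `u`. -/
def ones (u : ℕ → Fin 2) (n : ℕ) : ℤ := ∑ k ∈ Finset.range n, ((u k : ℕ) : ℤ)

/-- Any two blocks of the same length have numbers of ones that differ by at most one. -/
def IsBalanced (u : ℕ → Fin 2) : Prop :=
  ∀ k a b, ones u (a + k) - ones u a ≤ ones u (b + k) - ones u b + 1

theorem ones_zero (u : ℕ → Fin 2) : ones u 0 = 0 := by simp [ones]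

theorem ones_succ (u : ℕ → Fin 2) (n : ℕ) : ones u (n + 1) = ones u n + ((u n : ℕ) : ℤ) := by
  simp [ones, Finset.sum_range_succ]

/-- The block of `u` of length `n` at position `k`. -/
def block (u : ℕ → Fin 2) (n k : ℕ) : Fin n → Fin 2 := fun i => u (k + i)

theorem block_mem (u : ℕ → Fin 2) (n k : ℕ) : block u n k ∈ blocks u n := ⟨k, rfl⟩

theorem block_eq_iff {u : ℕ → Fin 2} {n i j : ℕ} :
    block u n i = block u n j ↔ ∀ s < n, u (i + s) = u (j + s) :=
  ⟨fun h s hs => congrFun h ⟨s, hs⟩, fun h => funext fun s => h s s.2⟩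

/-- Under such a period every block of length `j` already begins before position `j`, which leaves
at most `j` of them instead of `j + 1`. -/
theorem IsSturmian.not_eventually_periodic {u : ℕ → Fin 2} (hu : IsSturmian u) {i j : ℕ}
    (hij : i < j) : ¬ ∀ t, u (i + t) = u (j + t) := by
  intro h
  have hsub : blocks u j ⊆ ((Finset.range j).image (block u j) : Finset (Fin j → Fin 2)) := by
    rintro _ ⟨k, rfl⟩
    induction k using Nat.strong_induction_on with
    | _ k ih =>
      by_cases hk : k < j
      · simp only [Finset.coe_image, Set.mem_image, Finset.coe_range, Set.mem_Iio]
        exact ⟨k, hk, rfl⟩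
      · have := ih (k - (j - i)) (by omega)
        have heq : block u j k = block u j (k - (j - i)) := by
          rw [block_eq_iff]
          intro s _
          have := h (k - j + s)
          rw [show i + (k - j + s) = k - (j - i) + s by omega,
            show j + (k - j + s) = k + s by omega] at this
          exact this.symm
        change block u j k ∈ _
        rw [heq]
        exact this
  have h1 := Set.ncard_le_ncard hsub (Finset.finite_toSet _)
  rw [Set.ncard_coe_finset, hu j (by omega)] at h1
  have h2 := (Finset.card_image_le (s := Finset.range j) (f := block u j))
  simp at h2
  omega

/-- With no special position in `[i, j)`, each block met there determines the next letter, so from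
`i` on the blocks run round the same cycle forever and `u` is eventually periodic. -/
theorem IsSturmian.exists_special_between {u : ℕ → Fin 2} (hu : IsSturmian u) {n i j : ℕ}
    (hij : i < j) (h : block u n i = block u n j) : ∃ t, i ≤ t ∧ t < j ∧ IsSpecialAt u n t := by
  by_contra! hcon
  have key : ∀ t, block u n (i + t) = block u n (j + t) ∧
      ∃ r, i ≤ r ∧ r < j ∧ block u n (i + t) = block u n r := by
    intro t
    induction t with
    | zero => exact ⟨h, i, le_rfl, hij, rfl⟩
    | succ t ih =>
      obtain ⟨h1, r, hr1, hr2, hr⟩ := ih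
      have next : ∀ a, block u n a = block u n r → u (a + n) = u (r + n) := by
        intro a ha
        by_contra hne
        exact hcon r hr1 hr2 ⟨a, block_eq_iff.1 ha.symm, fun h => hne h.symm⟩
      have shift : ∀ a b, block u n a = block u n b → u (a + n) = u (b + n) →
          block u n (a + 1) = block u n (b + 1) := by
        intro a b hab hn
        rw [block_eq_iff] at hab ⊢
        intro s hs
        rcases Nat.lt_or_ge (s + 1) n with h' | h'
        · have := hab (s + 1) h'
          rwa [show a + 1 + s = a + (s + 1) by ring, show b + 1 + s = b + (s + 1) by ring]
        · rwa [show a + 1 + s = a + n by omega, show b + 1 + s = b + n by omega]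
      have e1 := next _ hr
      have e2 := next _ (h1.symm.trans hr)
      refine ⟨shift _ _ h1 (e1.trans e2.symm), ?_⟩
      have h3 : block u n (i + (t + 1)) = block u n (r + 1) := shift _ _ hr e1
      rcases Nat.lt_or_ge (r + 1) j with h' | h'
      · exact ⟨r + 1, by omega, h', h3⟩
      · exact ⟨i, le_rfl, hij, by rw [h3, show r + 1 = j by omega, h]⟩
  have hn : ∀ t, u (i + t + n) = u (j + t + n) := by
    intro t
    obtain ⟨h1, r, hr1, hr2, hr⟩ := key t
    have a1 : u (r + n) = u (i + t + n) := by
      by_contra hne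
      exact hcon r hr1 hr2 ⟨i + t, block_eq_iff.1 hr.symm, hne⟩
    have a2 : u (r + n) = u (j + t + n) := by
      by_contra hne
      exact hcon r hr1 hr2 ⟨j + t, block_eq_iff.1 (hr.symm.trans h1), hne⟩
    exact a1.symm.trans a2
  refine hu.not_eventually_periodic (i := i + n) (j := j + n) (by omega) fun t => ?_
  have := hn t
  rwa [show i + n + t = i + t + n by ring, show j + n + t = j + t + n by ring]

theorem finite_blocks (u : ℕ → Fin 2) (n : ℕ) : (blocks u n).Finite := Set.toFinite _

theorem IsSturmian.ncard_blocks {u : ℕ → Fin 2} (hu : IsSturmian u) (n : ℕ) :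
    (blocks u n).ncard = n + 1 := by
  rcases Nat.eq_zero_or_pos n with rfl | h
  · rw [zero_add, Set.ncard_eq_one]
    exact ⟨block u 0 0, Set.eq_singleton_iff_unique_mem.2
      ⟨block_mem u 0 0, fun x _ => Subsingleton.elim _ _⟩⟩
  · exact hu n h

theorem exists_lt_eq_of_mem {α : Type*} {s : Set α} (hs : s.Finite) (f : ℕ → α) (i n : ℕ)
    (hf : ∀ t ≤ n, f (i + t) ∈ s) (hc : s.ncard ≤ n) :
    ∃ a b, a < b ∧ b ≤ n ∧ f (i + a) = f (i + b) := by
  classical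
  obtain ⟨a, ha, b, hb, hne, hab⟩ := Finset.exists_ne_map_eq_of_card_lt_of_maps_to
    (s := Finset.range (n + 1)) (t := hs.toFinset) (f := fun t => f (i + t))
    (by rw [← Set.ncard_eq_toFinset_card s hs, Finset.card_range]; omega)
    (fun t ht => by
      simp only [Finset.coe_range, Set.mem_Iio] at ht
      simpa using hf t (by omega))
  simp only [Finset.mem_range] at ha hb
  rcases lt_or_gt_of_ne hne with h | h
  · exact ⟨a, b, h, by omega, hab⟩
  · exact ⟨b, a, h, by omega, hab.symm⟩

theorem IsSpecialAt.congr {u : ℕ → Fin 2} {n i k : ℕ} (h : IsSpecialAt u n i)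
    (hk : block u n i = block u n k) : IsSpecialAt u n k := by
  obtain ⟨j, hj, hne⟩ := h
  by_cases h : u (k + n) = u (j + n)
  · exact ⟨i, block_eq_iff.1 hk.symm, fun h' => hne (h'.symm.trans h)⟩
  · exact ⟨j, fun s hs => (block_eq_iff.1 hk s hs).symm.trans (hj s hs), h⟩

theorem IsSturmian.exists_special {u : ℕ → Fin 2} (hu : IsSturmian u) (n i : ℕ) :
    ∃ t ≤ n, IsSpecialAt u n (i + t) := by
  obtain ⟨a, b, hab, -, h⟩ := exists_lt_eq_of_mem (finite_blocks u n) (block u n) 0 (n + 1)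
    (fun t _ => block_mem u n _) (hu.ncard_blocks n).le
  obtain ⟨r, -, -, hr⟩ := hu.exists_special_between (by omega) h
  by_contra! hcon
  -- If the window `i, …, i + n` misses the special block, its `n + 1` positions carry at most `n`
  -- different blocks. A repetition then forces a special position in the window after all.
  have hfin : (blocks u n \ {block u n r}).Finite := (finite_blocks u n).sdiff
  obtain ⟨a, b, hab, hb, h⟩ := exists_lt_eq_of_mem hfin (block u n) i n
    (fun t ht => ⟨block_mem u n _, fun h => hcon t ht (hr.congr h.symm)⟩)
    (by rw [Set.ncard_sdiff_singleton_of_mem (block_mem u n r), hu.ncard_blocks]; simp)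
  obtain ⟨t, ht1, ht2, ht⟩ := hu.exists_special_between (by omega) h
  exact hcon (t - i) (by omega) (by rwa [show i + (t - i) = t by omega])

/-- One chosen extension per block gives `n + 1` blocks of length `n + 1`. Each special block adds a
further one, so two of them would give `n + 3`, one too many. -/
theorem IsSturmian.block_eq_of_special {u : ℕ → Fin 2} (hu : IsSturmian u) {n i j : ℕ}
    (hi : IsSpecialAt u n i) (hj : IsSpecialAt u n j) : block u n i = block u n j := by
  classical
  by_contra hne
  have hex : ∀ f : blocks u n, ∃ k, block u n k = f := fun f => f.2
  choose c hc using hex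
  let g : blocks u n → (Fin (n + 1) → Fin 2) := fun f => block u (n + 1) (c f)
  have trunc : ∀ {a b}, block u (n + 1) a = block u (n + 1) b → block u n a = block u n b := by
    intro a b h
    rw [block_eq_iff] at h ⊢
    exact fun s hs => h s (by omega)
  have ginj : Function.Injective g := fun a b h => by
    have := trunc h
    rw [hc, hc] at this
    exact Subtype.ext this
  have extra : ∀ i, IsSpecialAt u n i →
      ∃ k, block u n k = block u n i ∧ block u (n + 1) k ∉ Set.range g := by
    rintro i ⟨j, hj, hne⟩
    by_contra! h
    obtain ⟨f, hf⟩ := h i rfl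
    obtain ⟨f', hf'⟩ := h j (block_eq_iff.2 hj).symm
    have e : f = f' := by
      apply Subtype.ext
      rw [← hc f, ← hc f', trunc hf, trunc hf', block_eq_iff.2 hj]
    subst e
    exact hne (block_eq_iff.1 (hf.symm.trans hf') n (by omega))
  obtain ⟨k, hk, hk'⟩ := extra i hi
  obtain ⟨l, hl, hl'⟩ := extra j hj
  have hkl : block u (n + 1) k ∉ insert (block u (n + 1) l) (Set.range g) := by
    rintro (h | h)
    · exact hne (hk.symm.trans ((trunc h).trans hl))
    · exact hk' h
  have hsub : insert (block u (n + 1) k) (insert (block u (n + 1) l) (Set.range g)) ⊆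
      blocks u (n + 1) := by
    rintro _ (rfl | rfl | ⟨f, rfl⟩) <;> exact block_mem _ _ _
  have h1 := Set.ncard_le_ncard hsub (finite_blocks _ _)
  rw [Set.ncard_insert_of_notMem hkl (Set.toFinite _),
    Set.ncard_insert_of_notMem hl' (Set.toFinite _), hu.ncard_blocks] at h1
  have h2 : (Set.range g).ncard = n + 1 := by
    rw [← Set.image_univ, Set.ncard_image_of_injective _ ginj, Set.ncard_univ,
      Nat.card_coe_set_eq, hu.ncard_blocks]
  omega

/-! ### Sturmian sequences are balanced -/

theorem val_cases (x : Fin 2) : ((x : ℕ) : ℤ) = 0 ∧ x = 0 ∨ ((x : ℕ) : ℤ) = 1 ∧ x = 1 := by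
  fin_cases x <;> simp

theorem eq_of_val {x y : Fin 2} (h : ((x : ℕ) : ℤ) = ((y : ℕ) : ℤ)) : x = y :=
  Fin.ext (by exact_mod_cast h)

/-- A palindrome `w` cannot occur both as `1w1` and as `0w0` in a Sturmian sequence. -/
theorem IsSturmian.not_palindrome {u : ℕ → Fin 2} (hu : IsSturmian u) {m a b : ℕ}
    (hab : ∀ s < m, u (a + 1 + s) = u (b + 1 + s))
    (hpal : ∀ s < m, u (a + 1 + s) = u (a + m - s))
    (hfirst : u a ≠ u b) (ha : u (a + (m + 1)) = u a) (hb : u (b + (m + 1)) = u b) : False := by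
  have hspec : IsSpecialAt u m (a + 1) := by
    refine ⟨b + 1, hab, ?_⟩
    rw [show a + 1 + m = a + (m + 1) by ring, show b + 1 + m = b + (m + 1) by ring, ha, hb]
    exact hfirst
  -- the other case is the same with the roles of `a` and `b` exchanged
  have main : ∀ a b : ℕ, (∀ s < m, u (a + 1 + s) = u (b + 1 + s)) →
      (∀ s < m, u (a + 1 + s) = u (a + m - s)) → u a ≠ u b → u (a + (m + 1)) = u a →
      ∀ t ≤ m + 1, block u (m + 1) (a + t) = block u (m + 1) b → False := by
    intro a b hab hpal hfirst ha t ht h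
    rw [block_eq_iff] at h
    have h0 := h 0 (by omega)
    simp only [add_zero] at h0
    rcases Nat.eq_zero_or_pos t with rfl | htpos
    · exact hfirst h0
    · rcases Nat.lt_or_ge m t with hmt | hmt
      · rw [show a + t = a + (m + 1) by omega, ha] at h0
        exact hfirst h0
      -- The occurrence overlaps the final letter `u a`. Matching and the palindrome reflect that
      -- letter to position `a + t`, where the occurrence begins with `u b`.
      · have h1 := h (m + 1 - t) (by omega)
        rw [show a + t + (m + 1 - t) = a + (m + 1) by omega, ha] at h1
        have h2 := hab (m - t) (by omega)
        rw [show b + 1 + (m - t) = b + (m + 1 - t) by omega, ← h1] at h2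
        have h3 := hpal (m - t) (by omega)
        rw [h2, show a + m - (m - t) = a + t by omega, h0] at h3
        exact hfirst h3
  -- The special block of length `m + 1` ends in the special block `w` of length `m`, so it is `xw`
  -- with `x = u a` or `x = u b`. It must begin somewhere in each window of `m + 2` positions; the
  -- window spanned by the opposite one of `1w1`, `0w0` has no room for it.
  obtain ⟨r, -, hr⟩ := hu.exists_special (m + 1) 0
  rw [zero_add] at hr
  have hr' : IsSpecialAt u m (r + 1) := by
    obtain ⟨j, hj, hne⟩ := hr
    refine ⟨j + 1, fun s hs => ?_, ?_⟩
    · have := hj (s + 1) (by omega)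
      rwa [show r + 1 + s = r + (s + 1) by ring, show j + 1 + s = j + (s + 1) by ring]
    · rwa [show r + 1 + m = r + (m + 1) by ring, show j + 1 + m = j + (m + 1) by ring]
  have htail := block_eq_iff.1 (hu.block_eq_of_special hr' hspec)
  have ext : ∀ c, u r = u c → (∀ s < m, u (r + 1 + s) = u (c + 1 + s)) →
      block u (m + 1) r = block u (m + 1) c := by
    intro c h0 h1
    rw [block_eq_iff]
    rintro (_ | s) hs
    · exact h0
    · have := h1 s (by omega)
      rwa [show r + (s + 1) = r + 1 + s by ring, show c + (s + 1) = c + 1 + s by ring]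
  have hcase : u r = u a ∨ u r = u b := by
    have : ∀ x y z : Fin 2, y ≠ z → x = y ∨ x = z := by decide
    exact this _ _ _ hfirst
  rcases hcase with h | h
  · obtain ⟨t, ht, hs⟩ := hu.exists_special (m + 1) b
    refine main b a (fun s hs => (hab s hs).symm) ?_ (Ne.symm hfirst) hb t ht
      ((hu.block_eq_of_special hs hr).trans (ext a h htail))
    intro s hs
    have h1 := hab (m - 1 - s) (by omega)
    rw [← hab s hs, hpal s hs, show b + m - s = b + 1 + (m - 1 - s) by omega, ← h1]
    congr 1; omega
  · obtain ⟨t, ht, hs⟩ := hu.exists_special (m + 1) a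
    exact main a b hab hpal hfirst ha t ht ((hu.block_eq_of_special hs hr).trans
      (ext b h fun s hs => (htail s hs).trans (hab s hs)))

theorem IsSturmian.isBalanced {u : ℕ → Fin 2} (hu : IsSturmian u) : IsBalanced u := by
  classical
  by_contra hcon
  unfold IsBalanced at hcon
  push Not at hcon
  -- In a shortest unbalanced pair, minimality makes every proper nonempty prefix differ by exactly
  -- one. The pair is therefore `1w1`, `0w0`, and comparing `1` + prefix of `w` with suffix of `w` +
  -- `0` (and conversely) shows that `w` is a palindrome.
  obtain ⟨a, b, hk⟩ := Nat.find_spec hcon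
  have hmin : ∀ l < Nat.find hcon, ∀ a b,
      ones u (a + l) - ones u a ≤ ones u (b + l) - ones u b + 1 := by
    intro l hl
    have := Nat.find_min hcon hl
    push Not at this
    exact this
  generalize Nat.find hcon = k at hk hmin
  have hk2 : 2 ≤ k := by
    by_contra h
    have h' : k = 0 ∨ k = 1 := by omega
    rcases h' with rfl | rfl
    · simp at hk
    · rw [ones_succ, ones_succ] at hk
      rcases val_cases (u a) with h | h <;> rcases val_cases (u b) with h' | h' <;> omega
  obtain ⟨m, rfl⟩ : ∃ m, k = m + 2 := ⟨k - 2, by omega⟩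
  -- differences of prefixes
  have hd : ∀ l, 1 ≤ l → l ≤ m + 1 →
      (ones u (a + l) - ones u a) = (ones u (b + l) - ones u b) + 1 := by
    intro l h1 h2
    have e1 := hmin l (by omega) a b
    have e2 := hmin (m + 2 - l) (by omega) (a + l) (b + l)
    rw [show a + l + (m + 2 - l) = a + (m + 2) by omega,
      show b + l + (m + 2 - l) = b + (m + 2) by omega] at e2
    omega
  have ha0 : ((u a : ℕ) : ℤ) = 1 ∧ ((u b : ℕ) : ℤ) = 0 := by
    have := hd 1 le_rfl (by omega)
    rw [ones_succ, ones_succ] at this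
    rcases val_cases (u a) with h | h <;> rcases val_cases (u b) with h' | h' <;> omega
  have hlast : ((u (a + (m + 1)) : ℕ) : ℤ) = 1 ∧ ((u (b + (m + 1)) : ℕ) : ℤ) = 0 := by
    have := hd (m + 1) (by omega) le_rfl
    rw [show a + (m + 2) = a + (m + 1) + 1 by ring, show b + (m + 2) = b + (m + 1) + 1 by ring,
      ones_succ, ones_succ] at hk
    rcases val_cases (u (a + (m + 1))) with h | h <;>
      rcases val_cases (u (b + (m + 1))) with h' | h' <;> omega
  have hab : ∀ s < m, u (a + 1 + s) = u (b + 1 + s) := by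
    intro s hs
    have e1 := hd (s + 1) (by omega) (by omega)
    have e2 := hd (s + 2) (by omega) (by omega)
    rw [show a + (s + 2) = a + (s + 1) + 1 by ring, show b + (s + 2) = b + (s + 1) + 1 by ring,
      ones_succ, ones_succ] at e2
    apply eq_of_val
    rw [show a + 1 + s = a + (s + 1) by ring, show b + 1 + s = b + (s + 1) by ring]
    omega
  -- prefixes and suffixes of the common middle part have the same number of ones
  have hP : ∀ t ≤ m, ones u (a + 1 + t) - ones u (a + 1) =
      ones u (a + (m + 1)) - ones u (a + (m + 1) - t) := by
    intro t ht
    have f1 := hmin (t + 1) (by omega) a (b + (m + 1) - t)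
    have f2 := hmin (t + 1) (by omega) (a + (m + 1) - t) b
    have g1 := hd (m + 1) (by omega) le_rfl
    have g2 := hd (m + 1 - t) (by omega) (by omega)
    have g3 := hd (1 + t) (by omega) (by omega)
    have a1 := ones_succ u a
    have b1 := ones_succ u b
    have a2 := ones_succ u (a + (m + 1))
    have b2 := ones_succ u (b + (m + 1))
    rw [show a + (m + 1) - t + (t + 1) = a + (m + 1) + 1 by omega] at f2
    rw [show b + (m + 1) - t + (t + 1) = b + (m + 1) + 1 by omega] at f1
    rw [show a + (m + 1 - t) = a + (m + 1) - t by omega,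
      show b + (m + 1 - t) = b + (m + 1) - t by omega] at g2
    rw [show a + (t + 1) = a + 1 + t by ring] at f1
    rw [show b + (t + 1) = b + 1 + t by ring] at f2
    rw [show a + (1 + t) = a + 1 + t by ring, show b + (1 + t) = b + 1 + t by ring] at g3
    omega
  refine hu.not_palindrome hab ?_ ?_ ?_ ?_
  · intro s hs
    have e1 := hP s (by omega)
    have e2 := hP (s + 1) (by omega)
    rw [← add_assoc, ones_succ] at e2
    have e3 := ones_succ u (a + m - s)
    rw [show a + m - s + 1 = a + (m + 1) - s by omega] at e3
    rw [show a + (m + 1) - (s + 1) = a + m - s by omega] at e2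
    apply eq_of_val
    omega
  · intro h
    rw [h] at ha0
    omega
  · exact eq_of_val (by omega)
  · exact eq_of_val (by omega)

/-! ### The slope of a Sturmian sequence -/

theorem IsBalanced.mul_le_ones {u : ℕ → Fin 2} (hu : IsBalanced u) (k m l : ℕ) :
    (l : ℤ) * (ones u (m + k) - ones u m - 1) ≤ ones u (l * k) := by
  induction l with
  | zero => simp [ones_zero]
  | succ l ih =>
    have := hu k m (l * k)
    rw [show (l + 1) * k = l * k + k by ring]
    push_cast
    linarith

theorem IsBalanced.ones_le_mul {u : ℕ → Fin 2} (hu : IsBalanced u) (k m l : ℕ) :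
    ones u (l * k) ≤ (l : ℤ) * (ones u (m + k) - ones u m + 1) := by
  induction l with
  | zero => simp [ones_zero]
  | succ l ih =>
    have := hu k (l * k) m
    rw [show (l + 1) * k = l * k + k by ring]
    push_cast
    linarith

theorem IsBalanced.exists_density {u : ℕ → Fin 2} (hu : IsBalanced u) :
    ∃ α : ℝ, ∀ k m : ℕ, |((ones u (m + k) - ones u m : ℤ) : ℝ) - k * α| ≤ 1 := by
  -- `A` collects the lower bounds that blocks put on the density. Comparing with the first `k * l`
  -- terms, cut in two ways, shows that each is at most every upper bound, so `sSup A` satisfies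
  -- both.
  set A : Set ℝ :=
    {x | ∃ k m : ℕ, 0 < k ∧ x = ((ones u (m + k) - ones u m - 1 : ℤ) : ℝ) / k} with hA
  have hle : ∀ l n : ℕ, 0 < l → ∀ x ∈ A, x ≤ ((ones u (n + l) - ones u n + 1 : ℤ) : ℝ) / l := by
    rintro l n hl _ ⟨k, m, hk, rfl⟩
    have h1 := hu.mul_le_ones k m l
    have h2 := hu.ones_le_mul l n k
    rw [mul_comm l k] at h1
    have h3 : ((l : ℤ) * (ones u (m + k) - ones u m - 1) : ℝ) ≤
        ((k : ℤ) * (ones u (n + l) - ones u n + 1) : ℝ) := by exact_mod_cast h1.trans h2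
    rw [div_le_div_iff₀ (by positivity) (by positivity)]
    push_cast at h3 ⊢
    linarith
  refine ⟨sSup A, fun k m => ?_⟩
  rcases Nat.eq_zero_or_pos k with rfl | hk
  · simp
  have hk' : (0 : ℝ) < k := by exact_mod_cast hk
  have hne : A.Nonempty := ⟨_, k, m, hk, rfl⟩
  have h1 := csSup_le hne (hle k m hk)
  have h2 := le_csSup ⟨_, hle k m hk⟩ (show _ ∈ A from ⟨k, m, hk, rfl⟩)
  rw [le_div_iff₀ hk'] at h1
  rw [div_le_iff₀ hk'] at h2
  push_cast at h1 h2 ⊢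
  rw [abs_le]
  constructor <;> linarith

/-- For `σ = ±1`, the signed deviations of length-`q` blocks from `p` are nonnegative integers. Two
nonzero ones in a residue class mod `q` would add up to at least `2` over a long block, so each
class contains at most one. -/
theorem finite_setOf_ones_ne {u : ℕ → Fin 2} {p : ℤ} {q : ℕ} (hq : 0 < q) (σ : ℤ)
    (hpos : ∀ n, 0 ≤ σ * (ones u (n + q) - ones u n - p))
    (hbound : ∀ n k : ℕ, σ * (ones u (n + k * q) - ones u n - k * p) ≤ 1) :
    {n | σ * (ones u (n + q) - ones u n - p) ≠ 0}.Finite := by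
  have hnonneg : ∀ k n : ℕ, 0 ≤ σ * (ones u (n + k * q) - ones u n - k * p) := by
    intro k n
    induction k with
    | zero => simp
    | succ k ih =>
      have := hpos (n + k * q)
      rw [show n + (k + 1) * q = n + k * q + q by ring]
      push_cast
      linarith
  refine Set.Finite.of_finite_image (f := fun n => n % q)
    ((Finset.finite_toSet (Finset.range q)).subset ?_) ?_
  · rintro _ ⟨n, -, rfl⟩
    simpa using Nat.mod_lt n hq
  · have key : ∀ a b : ℕ, a < b → a % q = b % q →
        σ * (ones u (a + q) - ones u a - p) ≠ 0 →
        σ * (ones u (b + q) - ones u b - p) ≠ 0 → False := by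
      intro a b hab hmod ha hb
      obtain ⟨c, hc⟩ := (Nat.modEq_iff_dvd' hab.le).1 hmod
      obtain ⟨k, rfl⟩ : ∃ k, c = k + 1 := Nat.exists_eq_succ_of_ne_zero (by
        rintro rfl
        omega)
      obtain rfl : b = a + q + k * q := by
        have : b = a + q * (k + 1) := by omega
        rw [this]; ring
      have h1 := hpos a
      have h2 := hpos (a + q + k * q)
      have h3 := hnonneg k (a + q)
      have h4 := hbound a (k + 2)
      rw [show a + (k + 2) * q = a + q + k * q + q by ring] at h4
      have h1' := lt_of_le_of_ne h1 (Ne.symm ha)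
      have h2' := lt_of_le_of_ne h2 (Ne.symm hb)
      push_cast at h4
      linarith
    intro a ha b hb hab
    rcases lt_trichotomy a b with h | h | h
    · exact (key a b h hab ha hb).elim
    · exact h
    · exact (key b a h hab.symm hb ha).elim

theorem IsSturmian.irrational_density {u : ℕ → Fin 2} (hu : IsSturmian u) {α : ℝ}
    (hα : ∀ k m : ℕ, |((ones u (m + k) - ones u m : ℤ) : ℝ) - k * α| ≤ 1) : Irrational α := by
  rintro ⟨r, rfl⟩
  set q := r.den
  set p := r.num
  have hq : 0 < q := r.den_pos
  have hr : (q : ℝ) * (r : ℝ) = p := by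
    rw [mul_comm]
    exact_mod_cast Rat.mul_den_eq_num r
  have hb : ∀ n k : ℕ, |ones u (n + k * q) - ones u n - k * p| ≤ 1 := by
    intro n k
    have := hα (k * q) n
    push_cast at this
    rw [mul_assoc, hr] at this
    exact_mod_cast this
  have hb1 : ∀ n : ℕ, |ones u (n + q) - ones u n - p| ≤ 1 := by
    intro n
    simpa using hb n 1
  have hfin : {n | ones u (n + q) - ones u n - p ≠ 0}.Finite := by
    -- By balance the deviations from `p` cannot take both signs, so one choice of `σ` applies.
    by_cases h : ∀ n, 0 ≤ ones u (n + q) - ones u n - p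
    · have := finite_setOf_ones_ne (u := u) (p := p) hq 1 (by simpa using h)
        (fun n k => by rw [one_mul]; exact (abs_le.1 (hb n k)).2)
      simpa using this
    · push Not at h
      obtain ⟨m, hm⟩ := h
      have := finite_setOf_ones_ne (u := u) (p := p) hq (-1)
        (fun n => by have := hu.isBalanced q n m; omega)
        (fun n k => by have := (abs_le.1 (hb n k)).1; linarith)
      refine this.subset fun n hn => ?_
      simp only [Set.mem_ofPred_eq] at hn ⊢
      omega
  obtain ⟨N, hN⟩ := hfin.bddAbove
  refine hu.not_eventually_periodic (i := N + 1) (j := N + 1 + q) (by omega) fun t => ?_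
  have hz : ∀ n, N < n → ones u (n + q) - ones u n - p = 0 := by
    intro n hn
    by_contra h
    exact absurd (hN h) (by omega)
  have h1 := hz (N + 1 + t) (by omega)
  have h2 := hz (N + 1 + t + 1) (by omega)
  rw [show N + 1 + t + 1 + q = N + 1 + q + t + 1 by ring, ones_succ, ones_succ] at h2
  rw [show N + 1 + t + q = N + 1 + q + t by ring] at h1
  exact eq_of_val (by omega)

theorem IsSturmian.exists_hasSlope {u : ℕ → Fin 2} (hu : IsSturmian u) : ∃ α, HasSlope u α := by
  obtain ⟨α, hα⟩ := hu.isBalanced.exists_density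
  have hirr := hu.irrational_density hα
  refine ⟨α, ?_⟩
  set D : ℕ → ℝ := fun n => ones u n - n * α with hD
  have hDle : ∀ m n, D m ≤ D n + 1 := by
    intro m n
    rcases le_total m n with h | h
    · obtain ⟨k, rfl⟩ := Nat.exists_eq_add_of_le h
      have := (abs_le.1 (hα k m)).1
      simp only [hD]
      push_cast at this ⊢
      linarith
    · obtain ⟨k, rfl⟩ := Nat.exists_eq_add_of_le h
      have := (abs_le.1 (hα k n)).2
      simp only [hD]
      push_cast at this ⊢
      linarith
  have hbdd : BddAbove (Set.range D) := ⟨D 0 + 1, by rintro _ ⟨n, rfl⟩; exact hDle n 0⟩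
  set ρ := ⨆ n, D n with hρ
  have h1 : ∀ n, D n ≤ ρ := fun n => le_ciSup hbdd n
  have h2 : ∀ n, ρ ≤ D n + 1 := fun n => ciSup_le fun m => hDle m n
  have hu' : ∀ n, ((u n : ℕ) : ℤ) = ones u (n + 1) - ones u n := fun n => by
    rw [ones_succ]; ring
  -- Always `D n ≤ ρ ≤ D n + 1`. If the right inequality is strict throughout, floors recover `ones
  -- u n`. If it is an equality at `n₀`, irrationality makes the left one strict throughout, and
  -- ceilings with intercept `ρ - 1` do.
  by_cases hfl : ∀ n, ρ < D n + 1
  · have : ∀ n : ℕ, ⌊(n : ℝ) * α + ρ⌋ = ones u n := by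
      intro n
      rw [Int.floor_eq_iff]
      have a := h1 n
      have b := hfl n
      simp only [hD] at a b
      constructor <;> linarith
    refine ⟨ρ, Or.inl fun n => ?_⟩
    have e := this (n + 1)
    push_cast at e
    rw [e, this, hu']
  · push Not at hfl
    obtain ⟨n₀, hn₀⟩ := hfl
    have hlt : ∀ n, D n < ρ := by
      intro n
      refine lt_of_le_of_ne (h1 n) fun h => ?_
      have e : D n = D n₀ + 1 := by linarith [h2 n₀]
      simp only [hD] at e
      have hne : ((n : ℤ) - n₀) ≠ 0 := by
        intro h0
        have : n = n₀ := by omega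
        rw [this] at e
        linarith
      refine (hirr.intCast_mul hne).ne_int (ones u n - ones u n₀ - 1) ?_
      push_cast
      linarith
    have : ∀ n : ℕ, ⌈(n : ℝ) * α + (ρ - 1)⌉ = ones u n := by
      intro n
      rw [Int.ceil_eq_iff]
      have a := h2 n
      have b := hlt n
      simp only [hD] at a b
      constructor <;> linarith
    refine ⟨ρ - 1, Or.inr fun n => ?_⟩
    have e := this (n + 1)
    push_cast at e
    rw [e, this, hu']

theorem HasSlope.abs_ones_sub_le {u : ℕ → Fin 2} {α : ℝ} (h : HasSlope u α) (n : ℕ) :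
    |(ones u n : ℝ) - n * α| ≤ 1 := by
  obtain ⟨ρ, h | h⟩ := h
  · have : ones u n = ⌊(n : ℝ) * α + ρ⌋ - ⌊ρ⌋ := by
      induction n with
      | zero => simp [ones_zero]
      | succ n ih => rw [ones_succ, ih, h]; push_cast; ring
    rw [this, abs_le]
    have := Int.floor_le ρ
    have := Int.lt_floor_add_one ρ
    have := Int.floor_le ((n : ℝ) * α + ρ)
    have := Int.lt_floor_add_one ((n : ℝ) * α + ρ)
    push_cast
    constructor <;> linarith
  · have : ones u n = ⌈(n : ℝ) * α + ρ⌉ - ⌈ρ⌉ := by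
      induction n with
      | zero => simp [ones_zero]
      | succ n ih => rw [ones_succ, ih, h]; push_cast; ring
    rw [this, abs_le]
    have := Int.le_ceil ρ
    have := Int.ceil_lt_add_one ρ
    have := Int.le_ceil ((n : ℝ) * α + ρ)
    have := Int.ceil_lt_add_one ((n : ℝ) * α + ρ)
    push_cast
    constructor <;> linarith

theorem HasSlope.tendsto_ones_div {u : ℕ → Fin 2} {α : ℝ} (h : HasSlope u α) :
    Tendsto (fun n : ℕ => (ones u n : ℝ) / n) atTop (𝓝 α) := by
  rw [tendsto_iff_norm_sub_tendsto_zero]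
  refine squeeze_zero' (Eventually.of_forall fun _ => norm_nonneg _) ?_
    tendsto_one_div_atTop_nhds_zero_nat
  filter_upwards [eventually_gt_atTop 0] with n hn
  have hn' : (0 : ℝ) < n := by exact_mod_cast hn
  rw [Real.norm_eq_abs, div_sub' hn'.ne', abs_div, abs_of_pos hn']
  gcongr
  exact h.abs_ones_sub_le n

theorem IsSturmian.irrational_slope {u : ℕ → Fin 2} (hu : IsSturmian u) {α : ℝ}
    (h : HasSlope u α) : Irrational α := by
  rintro ⟨r, rfl⟩
  have hr : (r.den : ℝ) * (r : ℝ) = r.num := by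
    rw [mul_comm]
    exact_mod_cast Rat.mul_den_eq_num r
  refine hu.not_eventually_periodic (i := 0) (j := r.den) r.den_pos fun t => ?_
  have e1 : ∀ ρ : ℝ, ((r.den + t : ℕ) : ℝ) * r + ρ = t * r + ρ + (r.num : ℤ) := by
    intro ρ; push_cast; linarith
  have e2 : ∀ ρ : ℝ, (((r.den + t : ℕ) : ℝ) + 1) * r + ρ = (t + 1) * r + ρ + (r.num : ℤ) := by
    intro ρ; push_cast; linarith
  rw [zero_add]
  apply eq_of_val
  obtain ⟨ρ, h | h⟩ := h
  · rw [h, h, e1, e2, Int.floor_add_intCast, Int.floor_add_intCast]; ring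
  · rw [h, h, e1, e2, Int.ceil_add_intCast, Int.ceil_add_intCast]; ring

theorem IsSturmian.existsUnique_hasSlope {u : ℕ → Fin 2} (hu : IsSturmian u) :
    ∃! α, HasSlope u α := by
  obtain ⟨α, hα⟩ := hu.exists_hasSlope
  exact ⟨α, hα, fun β hβ => tendsto_nhds_unique hβ.tendsto_ones_div hα.tendsto_ones_div⟩

/-! ### Perimeters of convex sets in a box -/

/-- The ray is connected and its part in `K` is nonempty but, `K` being bounded, not everything. -/
theorem exists_ray_mem_frontier {E : Type*} [NormedAddCommGroup E] [NormedSpace ℝ E] {K : Set E}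
    (hK : Bornology.IsBounded K) {x v : E} (hx : x ∈ K) (hv : v ≠ 0) :
    ∃ s : ℝ, 0 ≤ s ∧ x + s • v ∈ frontier K := by
  let f : Set.Ici (0 : ℝ) → E := fun s => x + (s : ℝ) • v
  have hf : Continuous f := by fun_prop
  have : PreconnectedSpace (Set.Ici (0 : ℝ)) :=
    isPreconnected_iff_preconnectedSpace.1 isPreconnected_Ici
  have hne : (frontier (f ⁻¹' K)).Nonempty := by
    rw [nonempty_frontier_iff]
    refine ⟨⟨⟨0, Set.self_mem_Ici⟩, by simpa [f] using hx⟩, fun huniv => ?_⟩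
    obtain ⟨R, hR⟩ := hK.subset_closedBall x
    have hv' : 0 < ‖v‖ := norm_pos_iff.2 hv
    have hs : (0 : ℝ) ≤ (|R| + 1) / ‖v‖ := by positivity
    have : (⟨_, hs⟩ : Set.Ici (0 : ℝ)) ∈ f ⁻¹' K := by rw [huniv]; trivial
    have := hR this
    simp only [Metric.mem_closedBall, f, dist_eq_norm, add_sub_cancel_left, norm_smul,
      Real.norm_eq_abs, abs_of_nonneg hs] at this
    rw [div_mul_cancel₀ _ hv'.ne'] at this
    linarith [le_abs_self R]
  obtain ⟨s, hs⟩ := hne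
  exact ⟨s, s.2, hf.frontier_preimage_subset _ hs⟩

/-- The first coordinate does not increase one-dimensional Hausdorff measure. -/
theorem volume_coord_image_le (s : Set Plane) : volume ((fun z : Plane => z 0) '' s) ≤ μH[1] s := by
  have hl : LipschitzWith 1 (fun z : Plane => z 0) := by
    refine LipschitzWith.of_dist_le_mul fun x y => ?_
    rw [NNReal.coe_one, one_mul, dist_eq_norm, dist_eq_norm]
    exact PiLp.norm_apply_le (x - y) 0
  have := hl.hausdorffMeasure_image_le zero_le_one s
  rw [hausdorffMeasure_real] at this
  simpa using this

theorem volume_le_hausdorffMeasure {s : Set Plane} {a b : ℝ}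
    (h : ∀ t ∈ Set.Ioo a b, ∃ z ∈ s, z 0 = t) : ENNReal.ofReal (b - a) ≤ μH[1] s := by
  rw [← Real.volume_Ioo]
  refine le_trans (measure_mono fun t ht => ?_) (volume_coord_image_le s)
  obtain ⟨z, hz, rfl⟩ := h t ht
  exact ⟨z, hz, rfl⟩

/-- A convex set with interior points that reaches from the line `x = a` to the line `x = b`
contains the graph over `(a, b)` of a measurable function in its interior. -/
theorem exists_measurable_graph_mem_interior {K : Set Plane} (hK : Convex ℝ K)
    (hint : (interior K).Nonempty) {p q : Plane} (hp : p ∈ K) (hq : q ∈ K) :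
    ∃ h : ℝ → ℝ, Measurable h ∧
      ∀ t ∈ Set.Ioo (p 0) (q 0), ∃ z ∈ interior K, z 0 = t ∧ z 1 = h t := by
  obtain ⟨c, hc⟩ := hint
  -- The broken line from `p` through the interior point `c` to `q`; apart from its endpoints it
  -- stays in the interior.
  let h : ℝ → ℝ := fun t =>
    if t < c 0 then p 1 + (t - p 0) / (c 0 - p 0) * (c 1 - p 1)
    else q 1 + (t - q 0) / (c 0 - q 0) * (c 1 - q 1)
  refine ⟨h, ?_, fun t ht => ?_⟩
  · refine Measurable.ite measurableSet_Iio ?_ ?_ <;> fun_prop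
  rcases lt_trichotomy t (c 0) with htc | htc | htc
  · have hpos : 0 < c 0 - p 0 := by linarith [ht.1]
    refine ⟨_, hK.add_smul_sub_mem_interior hp hc (t := (t - p 0) / (c 0 - p 0))
      ⟨div_pos (by linarith [ht.1]) hpos, (div_le_one hpos).2 (by linarith)⟩, ?_, ?_⟩
    · simp [div_mul_cancel₀ _ hpos.ne']
    · simp [h, htc]
  · refine ⟨c, hc, htc.symm, ?_⟩
    have : c 0 - q 0 ≠ 0 := by linarith [ht.2]
    simp only [h, htc, lt_irrefl, if_false]
    rw [div_self this]; ring
  · have hneg : c 0 - q 0 < 0 ∨ 0 ≤ c 0 - q 0 := lt_or_ge _ _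
    rcases hneg with hneg | hneg
    · refine ⟨_, hK.add_smul_sub_mem_interior hq hc (t := (t - q 0) / (c 0 - q 0))
        ⟨div_pos_of_neg_of_neg (by linarith [ht.2]) hneg,
          (div_le_one_of_neg hneg).2 (by linarith)⟩, ?_, ?_⟩
      · simp [div_mul_cancel₀ _ hneg.ne]
      · simp [h, not_lt.2 htc.le]
    · linarith [ht.2]

/-- Vertical rays up and down from an interior graph meet the frontier on both sides of it.
Measurability of the graph lets the two parts be measured separately, and each projects onto the
whole interval. -/
theorem two_mul_le_hausdorffMeasure_frontier {K : Set Plane} (hK : Convex ℝ K)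
    (hb : Bornology.IsBounded K) (hint : (interior K).Nonempty) {p q : Plane} (hp : p ∈ K)
    (hq : q ∈ K) : 2 * ENNReal.ofReal (q 0 - p 0) ≤ μH[1] (frontier K) := by
  obtain ⟨h, hm, hh⟩ := exists_measurable_graph_mem_interior hK hint hp hq
  have hray : ∀ σ : ℝ, σ ≠ 0 → ∀ t ∈ Set.Ioo (p 0) (q 0), ∃ s : ℝ, 0 < s ∧
      ∃ z ∈ frontier K, z 0 = t ∧ z 1 = h t + s * σ := by
    intro σ hσ t ht
    obtain ⟨z, hz, hz0, hz1⟩ := hh t ht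
    obtain ⟨s, hs, hmem⟩ := exists_ray_mem_frontier hb (interior_subset hz)
      (v := (!₂[0, σ] : Plane)) (fun h0 => hσ (by simpa using congrArg (fun z : Plane => z 1) h0))
    refine ⟨s, lt_of_le_of_ne hs ?_, _, hmem, by simp [hz0], by simp [hz1]⟩
    rintro rfl
    rw [zero_smul, add_zero] at hmem
    exact hmem.2 hz
  have hmeas : MeasurableSet {z : Plane | h (z 0) < z 1} :=
    measurableSet_lt (hm.comp (by fun_prop)) (by fun_prop)
  rw [← measure_inter_add_sdiff (frontier K) hmeas, two_mul]
  refine add_le_add (volume_le_hausdorffMeasure fun t ht => ?_)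
    (volume_le_hausdorffMeasure fun t ht => ?_)
  · obtain ⟨s, hs, z, hz, hz0, hz1⟩ := hray 1 one_ne_zero t ht
    exact ⟨z, ⟨hz, by simp only [Set.mem_ofPred_eq]; rw [hz0, hz1]; linarith⟩, hz0⟩
  · obtain ⟨s, hs, z, hz, hz0, hz1⟩ := hray (-1) (by norm_num) t ht
    exact ⟨z, ⟨hz, by simp only [Set.mem_ofPred_eq, not_lt]; rw [hz0, hz1]; linarith⟩, hz0⟩

/-- The boundary of a convex set is no longer than that of a bounded set around it. -/
theorem hausdorffMeasure_frontier_le_of_subset {E : Type*} [NormedAddCommGroup E]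
    [InnerProductSpace ℝ E] [CompleteSpace E] [MeasurableSpace E] [BorelSpace E] {K L : Set E}
    (hK : Convex ℝ K) (hKc : IsClosed K) (hint : (interior K).Nonempty) (hKL : K ⊆ L)
    (hL : Bornology.IsBounded L) {d : ℝ} (hd : 0 ≤ d) :
    μH[d] (frontier K) ≤ μH[d] (frontier L) := by
  have hex : ∀ x : frontier K, ∃ v : E, v ≠ 0 ∧ ∀ y ∈ K, inner ℝ v (y - x) ≤ 0 := by
    rintro ⟨x, hx⟩
    obtain ⟨f, hf, hfx⟩ := geometric_hahn_banach_of_nonempty_interior_point hK hx.2 hint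
    refine ⟨(InnerProductSpace.toDual ℝ E).symm f, by simpa using hf, fun y hy => ?_⟩
    rw [InnerProductSpace.toDual_symm_apply, map_sub]
    linarith [hfx y hy]
  choose v hv0 hv using hex
  have hmem : ∀ x : frontier K, (x : E) ∈ K := fun x => hKc.frontier_subset x.2
  have hex2 : ∀ x : frontier K, ∃ s : ℝ, 0 ≤ s ∧ (x : E) + s • v x ∈ frontier L :=
    fun x => exists_ray_mem_frontier hL (hKL (hmem x)) (hv0 x)
  choose s hs0 hs using hex2
  -- Each point moves along an outward normal until it meets `frontier L`. Since `v x` and `v y`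
  -- support `K` at `x` and `y`, this never brings two points closer.
  let F : frontier K → E := fun x => x + s x • v x
  have hF : AntilipschitzWith 1 F := by
    refine AntilipschitzWith.of_le_mul_dist fun x y => ?_
    rw [NNReal.coe_one, one_mul, Subtype.dist_eq, dist_eq_norm, dist_eq_norm]
    have h1 := mul_nonpos_of_nonneg_of_nonpos (hs0 x) (hv x y (hmem y))
    have h2 := mul_nonpos_of_nonneg_of_nonpos (hs0 y) (hv y x (hmem x))
    have h3 : ‖(x : E) - y‖ ^ 2 ≤ inner ℝ (F x - F y) ((x : E) - y) := by
      rw [← real_inner_self_eq_norm_sq]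
      have e : F x - F y = ((x : E) - y) + (s x • v x - s y • v y) := by
        simp only [F]; abel
      rw [e, inner_add_left, inner_sub_left (s x • v x), real_inner_smul_left,
        real_inner_smul_left]
      rw [← neg_sub (x : E) y, inner_neg_right] at h1
      linarith
    have h4 := real_inner_le_norm (F x - F y) ((x : E) - y)
    by_contra! hlt
    nlinarith [norm_nonneg (F x - F y)]
  have h1 := hF.le_hausdorffMeasure_image hd Set.univ
  rw [ENNReal.coe_one, ENNReal.one_rpow, one_mul,
    ← isometry_subtype_coe.hausdorffMeasure_image (Or.inl hd), Set.image_univ,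
    Subtype.range_coe] at h1
  refine h1.trans (measure_mono ?_)
  rintro _ ⟨x, -, rfl⟩
  exact hs x

/-- The box `[0, a] × [0, b]`. -/
def box (a b : ℝ) : Set Plane := {z | (0 ≤ z 0 ∧ z 0 ≤ a) ∧ 0 ≤ z 1 ∧ z 1 ≤ b}

theorem isClosed_box (a b : ℝ) : IsClosed (box a b) := by
  have h0 : Continuous fun z : Plane => z 0 := by fun_prop
  have h1 : Continuous fun z : Plane => z 1 := by fun_prop
  exact ((isClosed_le continuous_const h0).inter (isClosed_le h0 continuous_const)).inter
    ((isClosed_le continuous_const h1).inter (isClosed_le h1 continuous_const))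

theorem isBounded_box (a b : ℝ) : Bornology.IsBounded (box a b) := by
  refine (Metric.isBounded_closedBall (x := (0 : Plane)) (r := |a| + |b|)).subset ?_
  rintro z ⟨⟨h1, h2⟩, h3, h4⟩
  rw [mem_closedBall_zero_iff, EuclideanSpace.norm_eq, Fin.sum_univ_two]
  refine Real.sqrt_le_iff.2 ⟨by positivity, ?_⟩
  simp only [Real.norm_eq_abs, sq_abs]
  have := h2.trans (le_abs_self a)
  have := h4.trans (le_abs_self b)
  nlinarith

theorem convex_box (a b : ℝ) : Convex ℝ (box a b) := by
  have h0 : IsLinearMap ℝ fun z : Plane => z 0 := ⟨fun _ _ => rfl, fun _ _ => rfl⟩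
  have h1 : IsLinearMap ℝ fun z : Plane => z 1 := ⟨fun _ _ => rfl, fun _ _ => rfl⟩
  exact ((convex_halfSpace_ge h0 0).inter (convex_halfSpace_le h0 a)).inter
    ((convex_halfSpace_ge h1 0).inter (convex_halfSpace_le h1 b))

theorem mem_segment_of_coord {x y z : Plane} (t : ℝ) (h0 : 0 ≤ t) (h1 : t ≤ 1)
    (hx : z 0 = x 0 + t * (y 0 - x 0)) (hy : z 1 = x 1 + t * (y 1 - x 1)) : z ∈ segment ℝ x y := by
  rw [segment_eq_image']
  refine ⟨t, ⟨h0, h1⟩, ?_⟩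
  ext i
  fin_cases i
  · simp [hx]
  · simp [hy]

theorem hausdorffMeasure_frontier_box_le {a b : ℝ} (ha : 0 < a) (hb : 0 < b) :
    μH[1] (frontier (box a b)) ≤ ENNReal.ofReal (2 * a + 2 * b) := by
  have h0 : Continuous fun z : Plane => z 0 := by fun_prop
  have h1 : Continuous fun z : Plane => z 1 := by fun_prop
  have hsub : frontier (box a b) ⊆
      (segment ℝ (!₂[0, 0] : Plane) !₂[a, 0] ∪ segment ℝ (!₂[0, b] : Plane) !₂[a, b]) ∪
      (segment ℝ (!₂[0, 0] : Plane) !₂[0, b] ∪ segment ℝ (!₂[a, 0] : Plane) !₂[a, b]) := by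
    intro z hz
    have hzb := (isClosed_box a b).frontier_subset hz
    obtain ⟨⟨z1, z2⟩, z3, z4⟩ := hzb
    by_cases c3 : z 1 = 0
    · refine Or.inl (Or.inl (mem_segment_of_coord (z 0 / a) (by positivity)
        ((div_le_one ha).2 z2) ?_ ?_)) <;> simp [ha.ne', c3]
    by_cases c4 : z 1 = b
    · refine Or.inl (Or.inr (mem_segment_of_coord (z 0 / a) (by positivity)
        ((div_le_one ha).2 z2) ?_ ?_)) <;> simp [ha.ne', c4]
    by_cases c1 : z 0 = 0
    · refine Or.inr (Or.inl (mem_segment_of_coord (z 1 / b) (by positivity)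
        ((div_le_one hb).2 z4) ?_ ?_)) <;> simp [hb.ne', c1]
    by_cases c2 : z 0 = a
    · refine Or.inr (Or.inr (mem_segment_of_coord (z 1 / b) (by positivity)
        ((div_le_one hb).2 z4) ?_ ?_)) <;> simp [hb.ne', c2]
    exfalso
    refine hz.2 (mem_interior.2 ⟨{z : Plane | (0 < z 0 ∧ z 0 < a) ∧ 0 < z 1 ∧ z 1 < b},
      fun w hw => ⟨⟨hw.1.1.le, hw.1.2.le⟩, hw.2.1.le, hw.2.2.le⟩, ?_,
      ⟨lt_of_le_of_ne z1 (Ne.symm c1), lt_of_le_of_ne z2 c2⟩,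
      lt_of_le_of_ne z3 (Ne.symm c3), lt_of_le_of_ne z4 c4⟩)
    exact ((isOpen_lt continuous_const h0).inter (isOpen_lt h0 continuous_const)).inter
      ((isOpen_lt continuous_const h1).inter (isOpen_lt h1 continuous_const))
  refine (measure_mono hsub).trans ((measure_union_le _ _).trans ((add_le_add
    (measure_union_le _ _) (measure_union_le _ _)).trans (le_of_eq ?_)))
  simp only [hausdorffMeasure_segment, edist_dist, EuclideanSpace.dist_eq, Fin.sum_univ_two]
  simp only [Matrix.cons_val_zero, Matrix.cons_val_one, Real.dist_eq, sub_self,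
    abs_zero, zero_sub, abs_neg, sq_abs, ne_eq, OfNat.ofNat_ne_zero, not_false_eq_true, zero_pow,
    add_zero, zero_add, Real.sqrt_sq ha.le, Real.sqrt_sq hb.le]
  rw [← ENNReal.ofReal_add ha.le ha.le, ← ENNReal.ofReal_add hb.le hb.le,
    ← ENNReal.ofReal_add (by positivity) (by positivity)]
  congr 1; ring

theorem perimeter_bounds {K : Set Plane} (hK : Convex ℝ K) (hc : IsClosed K)
    (hint : (interior K).Nonempty) {a b : ℝ} (ha : 0 < a) (hb : 0 < b) (hsub : K ⊆ box a b)
    {p q : Plane} (hp : p ∈ K) (hq : q ∈ K) :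
    2 * (q 0 - p 0) ≤ perimeter K ∧ perimeter K ≤ 2 * a + 2 * b := by
  have h1 := two_mul_le_hausdorffMeasure_frontier hK ((isBounded_box a b).subset hsub) hint hp hq
  have h2 := (hausdorffMeasure_frontier_le_of_subset hK hc hint hsub (isBounded_box a b)
    zero_le_one).trans (hausdorffMeasure_frontier_box_le ha hb)
  have hfin : μH[1] (frontier K) ≠ ⊤ := ne_top_of_le_ne_top ENNReal.ofReal_ne_top h2
  rw [perimeter, if_pos hint]
  constructor
  · refine (ENNReal.ofReal_le_iff_le_toReal hfin).1 (le_of_eq_of_le ?_ h1)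
    rw [ENNReal.ofReal_mul zero_le_two, ENNReal.ofReal_ofNat]
  · exact ENNReal.toReal_le_of_le_ofReal (by positivity) h2

/-! ### The inconstancy of a Sturmian sequence -/

theorem toReal_cases (u : ℕ → Fin 2) (n : ℕ) :
    toReal u n = 0 ∧ u n = 0 ∨ toReal u n = 1 ∧ u n = 1 := by
  unfold toReal
  generalize u n = x
  fin_cases x <;> simp

/-- A nonzero second difference means that the three points are not collinear, so they span the
plane. -/
theorem interior_nonempty_of_graphPoint_mem {K : Set Plane} (hK : Convex ℝ K) {f : ℕ → ℝ} {n : ℕ}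
    (h0 : graphPoint f n ∈ K) (h1 : graphPoint f (n + 1) ∈ K) (h2 : graphPoint f (n + 2) ∈ K)
    (hne : f n + f (n + 2) - 2 * f (n + 1) ≠ 0) : (interior K).Nonempty := by
  rw [hK.interior_nonempty_iff_affineSpan_eq_top, ← AffineSubspace.coe_eq_univ_iff,
    Set.eq_univ_iff_forall]
  intro z
  set D := f n + f (n + 2) - 2 * f (n + 1) with hD
  set t := (z 1 - f n - (z 0 - n) * (f (n + 1) - f n)) / D with ht
  have m0 := subset_affineSpan ℝ K h0
  have m1 := subset_affineSpan ℝ K h1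
  have m2 := subset_affineSpan ℝ K h2
  have := AffineSubspace.smul_vsub_vadd_mem _ t m2 m0
    (AffineSubspace.smul_vsub_vadd_mem _ (z 0 - n - 2 * t) m1 m0 m0)
  refine (congrArg (· ∈ affineSpan ℝ K) ?_).mpr this
  ext i
  fin_cases i
  · simp [graphPoint]; ring
  · have : t * D = z 1 - f n - (z 0 - n) * (f (n + 1) - f n) := div_mul_cancel₀ _ hne
    simp [graphPoint]
    rw [hD] at this
    linarith

theorem graphPoint_mem_polyline (f : ℕ → ℝ) {n N : ℕ} (hn : n ≤ N) (hN : 0 < N) :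
    graphPoint f n ∈ polyline f N := by
  simp only [polyline, Set.mem_iUnion, Finset.mem_range]
  rcases Nat.lt_or_ge n N with h | h
  · exact ⟨n, h, left_mem_segment _ _ _⟩
  · obtain rfl : n = N := le_antisymm hn h
    obtain ⟨m, rfl⟩ := Nat.exists_eq_succ_of_ne_zero hN.ne'
    exact ⟨m, by omega, right_mem_segment _ _ _⟩

theorem convexHull_polyline (f : ℕ → ℝ) {N : ℕ} (hN : 0 < N) :
    convexHull ℝ (polyline f N) = convexHull ℝ (graphPoint f '' Set.Iic N) := by
  apply subset_antisymm
  · refine convexHull_min ?_ (convex_convexHull ℝ _)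
    simp only [polyline, Set.iUnion_subset_iff, Finset.mem_range]
    intro n hn
    exact (convex_convexHull ℝ _).segment_subset
      (subset_convexHull ℝ _ ⟨n, hn.le, rfl⟩) (subset_convexHull ℝ _ ⟨n + 1, hn, rfl⟩)
  · refine convexHull_mono ?_
    rintro _ ⟨n, hn, rfl⟩
    exact graphPoint_mem_polyline f hn hN

theorem IsSturmian.exists_ne_succ {u : ℕ → Fin 2} (hu : IsSturmian u) : ∃ n, u n ≠ u (n + 1) := by
  by_contra! h
  refine hu.not_eventually_periodic zero_lt_one fun t => ?_
  rw [zero_add, add_comm]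
  exact h t

theorem IsSturmian.eventually_perimeter_bounds {u : ℕ → Fin 2} (hu : IsSturmian u) :
    ∀ᶠ N : ℕ in atTop, 2 * (N : ℝ) ≤ perimeter (convexHull ℝ (polyline (toReal u) N)) ∧
      perimeter (convexHull ℝ (polyline (toReal u) N)) ≤ 2 * (N : ℝ) + 2 := by
  obtain ⟨n, hn⟩ := hu.exists_ne_succ
  -- From here on the curve contains the points at `n`, `n + 1`, `n + 2`; as `u` changes at `n` and
  -- takes only the values `0` and `1`, they are not collinear.
  filter_upwards [eventually_ge_atTop (n + 2)] with N hN
  have hN0 : 0 < N := by omega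
  have hN' : (0 : ℝ) < N := by exact_mod_cast hN0
  have hmem : ∀ k ≤ N, graphPoint (toReal u) k ∈ convexHull ℝ (polyline (toReal u) N) :=
    fun k hk => subset_convexHull ℝ _ (graphPoint_mem_polyline _ hk hN0)
  have hsub : convexHull ℝ (polyline (toReal u) N) ⊆ box N 1 := by
    rw [convexHull_polyline _ hN0]
    refine convexHull_min ?_ (convex_box _ _)
    rintro _ ⟨k, hk, rfl⟩
    have hk' : (k : ℝ) ≤ N := by exact_mod_cast hk
    rcases toReal_cases u k with h | h <;> simp [box, graphPoint, h.1, hk']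
  have hclosed : IsClosed (convexHull ℝ (polyline (toReal u) N)) := by
    rw [convexHull_polyline _ hN0]
    exact ((Set.finite_Iic N).image _).isClosed_convexHull ℝ
  have hint : (interior (convexHull ℝ (polyline (toReal u) N))).Nonempty := by
    refine interior_nonempty_of_graphPoint_mem (convex_convexHull ℝ _) (hmem n (by omega))
      (hmem (n + 1) (by omega)) (hmem (n + 2) hN) ?_
    rcases toReal_cases u n with h | h <;> rcases toReal_cases u (n + 1) with h' | h' <;>
      rcases toReal_cases u (n + 2) with h'' | h'' <;>
      first
        | exact absurd (h.2.trans h'.2.symm) hn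
        | (rw [h.1, h'.1, h''.1]; norm_num)
  have := perimeter_bounds (convex_convexHull ℝ _) hclosed hint hN' one_pos hsub
    (hmem 0 (by omega)) (hmem N le_rfl)
  simpa [graphPoint] using this

theorem IsSturmian.tendsto_perimeter_div {u : ℕ → Fin 2} (hu : IsSturmian u) :
    Tendsto (fun N : ℕ => perimeter (convexHull ℝ (polyline (toReal u) N)) / N) atTop (𝓝 2) := by
  have hlim : Tendsto (fun N : ℕ => 2 + 2 * (1 / (N : ℝ))) atTop (𝓝 2) := by
    simpa using (tendsto_one_div_atTop_nhds_zero_nat (𝕜 := ℝ)).const_mul 2 |>.const_add 2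
  refine tendsto_of_tendsto_of_tendsto_of_le_of_le' tendsto_const_nhds hlim ?_ ?_
  all_goals
    filter_upwards [hu.eventually_perimeter_bounds, eventually_gt_atTop 0] with N h hN
    have hN' : (0 : ℝ) < N := by exact_mod_cast hN
  · rw [le_div_iff₀ hN']
    exact h.1
  · rw [div_le_iff₀ hN', add_mul, mul_assoc, one_div_mul_cancel hN'.ne', mul_one]
    exact h.2

theorem polylineLength_eq {f c : ℕ → ℝ} (hc : ∀ n, c n = 0 ∨ c n = 1)
    (hd : ∀ n, (f n - f (n + 1)) ^ 2 = c n) (N : ℕ) :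
    polylineLength f N = N + (√2 - 1) * ∑ n ∈ Finset.range N, c n := by
  have : ∀ n, dist (graphPoint f n) (graphPoint f (n + 1)) = 1 + (√2 - 1) * c n := by
    intro n
    rw [EuclideanSpace.dist_eq, Fin.sum_univ_two]
    simp only [graphPoint, Real.dist_eq, sq_abs, Matrix.cons_val_zero, Matrix.cons_val_one, hd]
    rcases hc n with h | h
    · simp [h]
    · rw [h]; norm_num
  simp only [polylineLength, this, Finset.sum_add_distrib, Finset.mul_sum]
  simp

theorem IsSturmian.tendsto_finiteInconstancy {u : ℕ → Fin 2} (hu : IsSturmian u) {c : ℕ → ℝ}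
    (hc : ∀ n, c n = 0 ∨ c n = 1) (hd : ∀ n, (toReal u n - toReal u (n + 1)) ^ 2 = c n) {γ : ℝ}
    (hγ : Tendsto (fun N : ℕ => (∑ n ∈ Finset.range N, c n) / N) atTop (𝓝 γ)) :
    Tendsto (finiteInconstancy (toReal u)) atTop (𝓝 (1 + (√2 - 1) * γ)) := by
  have h1 : Tendsto (fun N : ℕ => 2 * (1 + (√2 - 1) * ((∑ n ∈ Finset.range N, c n) / N)) /
      (perimeter (convexHull ℝ (polyline (toReal u) N)) / N)) atTop
      (𝓝 (2 * (1 + (√2 - 1) * γ) / 2)) :=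
    (((hγ.const_mul _).const_add _).const_mul _).div hu.tendsto_perimeter_div two_ne_zero
  rw [mul_div_cancel_left₀ _ two_ne_zero] at h1
  refine h1.congr' ?_
  filter_upwards [eventually_gt_atTop 0] with N hN
  have hN' : (N : ℝ) ≠ 0 := by exact_mod_cast hN.ne'
  rw [finiteInconstancy, polylineLength_eq hc hd, ← mul_div_mul_right _ _ hN',
    div_mul_cancel₀ _ hN']
  congr 1
  field_simp

theorem sum_toReal_add_succ (u : ℕ → Fin 2) (N : ℕ) :
    ∑ n ∈ Finset.range N, (toReal u n + toReal u (n + 1)) =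
      2 * ones u N + (toReal u N - toReal u 0) := by
  induction N with
  | zero => simp [ones_zero]
  | succ N ih =>
    rw [Finset.sum_range_succ, ih, ones_succ]
    simp only [toReal]
    push_cast
    ring

theorem HasSlope.tendsto_sum_add_succ_div {u : ℕ → Fin 2} {α : ℝ} (h : HasSlope u α) :
    Tendsto (fun N : ℕ => (∑ n ∈ Finset.range N, (toReal u n + toReal u (n + 1))) / N) atTop
      (𝓝 (2 * α)) := by
  have h0 : Tendsto (fun N : ℕ => (toReal u N - toReal u 0) / N) atTop (𝓝 0) := by
    refine squeeze_zero_norm (fun N => ?_) tendsto_one_div_atTop_nhds_zero_nat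
    rw [norm_div, Real.norm_natCast]
    gcongr
    rcases toReal_cases u N with h | h <;> rcases toReal_cases u 0 with h' | h' <;>
      rw [h.1, h'.1] <;> norm_num
  have := (h.tendsto_ones_div.const_mul 2).add h0
  rw [add_zero] at this
  refine this.congr fun N => ?_
  rw [sum_toReal_add_succ, add_div, mul_div_assoc]

theorem IsSturmian.inconstancy_of_sum_div {u : ℕ → Fin 2} (hu : IsSturmian u) {c : ℕ → ℝ}
    (hc : ∀ n, c n = 0 ∨ c n = 1) (hd : ∀ n, (toReal u n - toReal u (n + 1)) ^ 2 = c n) {α : ℝ}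
    (hirr : Irrational α)
    (hα : Tendsto (fun N : ℕ => (∑ n ∈ Finset.range N, c n) / N) atTop (𝓝 (2 * α))) :
    0 < α ∧ α < 1 / 2 ∧
      Tendsto (finiteInconstancy (toReal u)) atTop (𝓝 (1 + 2 * (√2 - 1) * α)) ∧
      inconstancy (toReal u) = ((1 + 2 * (√2 - 1) * α : ℝ) : EReal) := by
  have hlim := hu.tendsto_finiteInconstancy hc hd hα
  rw [show 1 + (√2 - 1) * (2 * α) = 1 + 2 * (√2 - 1) * α by ring] at hlim
  have hsum : ∀ N : ℕ, 0 ≤ ∑ n ∈ Finset.range N, c n ∧ ∑ n ∈ Finset.range N, c n ≤ N := by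
    intro N
    constructor
    · refine Finset.sum_nonneg fun n _ => ?_
      rcases hc n with h | h <;> norm_num [h]
    · refine (Finset.sum_le_card_nsmul _ c 1 fun n _ => ?_).trans (by simp)
      rcases hc n with h | h <;> norm_num [h]
  have h0 : 0 ≤ 2 * α := ge_of_tendsto' hα fun N => div_nonneg (hsum N).1 N.cast_nonneg
  have h1 : 2 * α ≤ 1 := le_of_tendsto' hα fun N => div_le_one_of_le₀ (hsum N).2 N.cast_nonneg
  refine ⟨lt_of_le_of_ne (by linarith) (Ne.symm hirr.ne_zero), lt_of_le_of_ne (by linarith) ?_,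
    hlim, ((continuous_coe_real_ereal.tendsto _).comp hlim).limsup_eq⟩
  intro h
  exact hirr ⟨1 / 2, by rw [h]; norm_num⟩

theorem notMem_blocks_two {u : ℕ → Fin 2} {a : Fin 2} (h : ![a, a] ∉ blocks u 2) (n : ℕ) :
    ¬ (u n = a ∧ u (n + 1) = a) := by
  rintro ⟨h0, h1⟩
  refine h ⟨n, funext fun i => ?_⟩
  fin_cases i
  · simpa using h0
  · simpa using h1

end Inconstancy

open Inconstancy in
theorem mainTheorem5 (u : ℕ → Fin 2) (hu : Inconstancy.IsSturmian u) :
    (∃! β : ℝ, Inconstancy.HasSlope u β) ∧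
    (![1, 1] ∉ Inconstancy.blocks u 2 →
      ∀ α : ℝ, Inconstancy.HasSlope u α →
        0 < α ∧ α < 1 / 2 ∧
        Tendsto (Inconstancy.finiteInconstancy (Inconstancy.toReal u)) atTop
          (𝓝 (1 + 2 * (√2 - 1) * α)) ∧
        Inconstancy.inconstancy (Inconstancy.toReal u) =
          ((1 + 2 * (√2 - 1) * α : ℝ) : EReal)) ∧
    (![0, 0] ∉ Inconstancy.blocks u 2 →
      ∀ α : ℝ, Inconstancy.HasSlope u (1 - α) →
        0 < α ∧ α < 1 / 2 ∧
        Tendsto (Inconstancy.finiteInconstancy (Inconstancy.toReal u)) atTop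
          (𝓝 (1 + 2 * (√2 - 1) * α)) ∧
        Inconstancy.inconstancy (Inconstancy.toReal u) =
          ((1 + 2 * (√2 - 1) * α : ℝ) : EReal)) := by
  refine ⟨hu.existsUnique_hasSlope, fun h α hα => ?_, fun h α hα => ?_⟩
  · refine hu.inconstancy_of_sum_div (c := fun n => toReal u n + toReal u (n + 1))
      (fun n => ?_) (fun n => ?_) (hu.irrational_slope hα) hα.tendsto_sum_add_succ_div
    all_goals
      have hn := notMem_blocks_two h n
      rcases toReal_cases u n with h0 | h0 <;> rcases toReal_cases u (n + 1) with h1 | h1 <;>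
        first
          | (norm_num [h0.1, h1.1]; done)
          | exact (hn ⟨h0.2, h1.2⟩).elim
  · have hirr : Irrational α := by
      have := (hu.irrational_slope hα).ratCast_sub 1
      simpa using this
    refine hu.inconstancy_of_sum_div (c := fun n => 2 - (toReal u n + toReal u (n + 1)))
      (fun n => ?_) (fun n => ?_) hirr ?_
    rotate_left 2
    · have := hα.tendsto_sum_add_succ_div.const_sub 2
      rw [show 2 - 2 * (1 - α) = 2 * α by ring] at this
      refine this.congr' ?_
      filter_upwards [eventually_gt_atTop 0] with N hN
      have hN' : (N : ℝ) ≠ 0 := by exact_mod_cast hN.ne'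
      rw [Finset.sum_sub_distrib, Finset.sum_const, Finset.card_range, nsmul_eq_mul, sub_div,
        mul_div_cancel_left₀ _ hN']
    all_goals
      have hn := notMem_blocks_two h n
      rcases toReal_cases u n with h0 | h0 <;> rcases toReal_cases u (n + 1) with h1 | h1 <;>
        first
          | (norm_num [h0.1, h1.1]; done)
          | exact (hn ⟨h0.2, h1.2⟩).elim
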